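/- Let $\mathbb{F}$ be a finite field of odd cardinality $q$ with $q \ge 5$, and let $n \in \mathbb{N}$. Then every matrix $A \in \mathbb{M}_n(\mathbb{F})$ can be expressed as $A = D + M$, where $D \in \mathbb{M}_n(\mathbb{F})$ is diagonalizable over $\mathbb{F}$ (that is, $U^{-1} D U$ is diagonal for some invertible $U \in \mathbb{M}_n(\mathbb{F})$) and $M \in \mathbb{M}_n(\mathbb{F})$ satisfies $M^2 = 0$. In particular, $D^q = D$, so $A$ can be expressed as the sum of a $q$-potent matrix (a matrix $Z$ with $Z^q = Z$) and a square-zero matrix. -/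

import Mathlib

/-- A square matrix is diagonalizable over `F` if it is similar, through an invertible matrix with
entries in `F`, to a diagonal matrix with entries in `F`. -/
def Matrix.IsDiagonalizable {n : Type*} [Fintype n] [DecidableEq n] {F : Type*} [Field F]
    (X : Matrix n n F) : Prop :=
  ∃ (U : (Matrix n n F)ˣ) (d : n → F),
    (↑U⁻¹ : Matrix n n F) * X * (U : Matrix n n F) = Matrix.diagonal d

/-!
The matrix is regarded as an endomorphism `f`, and the space as an `F[X]`-module on which `X` acts
by `f`. By the structure theorem over a principal ideal domain this module is a direct sum of
cyclic modules `F[X] ⧸ (g)`. As the property of being the sum of a diagonalizable and a square-zero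
endomorphism passes to direct sums, only multiplication by `X` on `F[X] ⧸ (g)`, `deg g = n + 1`,
has to be decomposed.

For any scalars `a 0, …, a n` the polynomials `e j = (X - a 0) ⋯ (X - a (j - 1))`, `j ≤ n`, form a
basis of `F[X] ⧸ (g)`, and `f (e j) = a j • e j + e (j + 1)` for `j < n`. If moreover the `a i` add
up to the trace of `f`, then `f (e n) - a n • e n` lies in the span `E` of the `e j` with `j < n`.
Let `M` send `e j` to `e (j + 1)` when `j < n` and `n - j` is odd, and to `0` otherwise. Then
`M ^ 2 = 0`, and `D = f - M` acts on `E` by triangular blocks of size at most two, with diagonal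
entries `a j, a (j + 1)` for `n - j` even (and possibly one block of size one at the start). So `D`
is diagonalizable as soon as the two entries of each block differ and `a n` is none of the other
`a j`: the first condition makes `D` diagonalizable on `E`, and the second one makes `D - a n`
bijective on `E`, so that `e n` can be corrected by an element of `E` to an eigenvector
(`of_chain_basis`).

Scalars with these properties and any prescribed sum exist because the blocks may all carry
`r, -r`, so that only `a n`, and `a 0` if `n` is odd, contribute to the sum; the field has at least
five elements and odd characteristic, which leaves room to choose `r` (`exists_diagonal_entries`).
Finally, a diagonalizable matrix satisfies `D ^ q = D` because its eigenvalues do.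
-/

open Polynomial Module Finset
open scoped DirectSum Matrix

/-- An endomorphism that is the sum of an endomorphism whose eigenvectors span the space and of an
endomorphism with zero square. -/
def Module.End.IsDiagonalizableAddSqZero {F V : Type*} [Field F] [AddCommGroup V] [Module F V]
    (f : End F V) : Prop :=
  ∃ D M : End F V, f = D + M ∧ M * M = 0 ∧ ⨆ μ, D.eigenspace μ = ⊤

namespace Module.End.IsDiagonalizableAddSqZero

/-! ### Transport and direct sums -/

section Transport

variable {F : Type*} [Field F]

theorem of_linearEquiv {V W : Type*} [AddCommGroup V] [Module F V] [AddCommGroup W] [Module F W]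
    (e : V ≃ₗ[F] W) {f : End F V} {g : End F W} (h : ∀ x, e (f x) = g (e x))
    (hf : f.IsDiagonalizableAddSqZero) : g.IsDiagonalizableAddSqZero := by
  obtain ⟨D, M, rfl, hM, hD⟩ := hf
  refine ⟨e.conj D, e.conj M, ?_, ?_, ?_⟩
  · ext x
    have := h (e.symm x)
    simp only [LinearMap.add_apply, LinearEquiv.apply_symm_apply, map_add] at this
    simp [LinearEquiv.conj_apply, ← this]
  · rw [End.mul_eq_comp, ← LinearEquiv.conj_comp, ← End.mul_eq_comp, hM, map_zero]
  · rw [eq_top_iff, ← LinearEquiv.range e, LinearMap.range_eq_map, ← hD, Submodule.map_iSup]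
    refine iSup_mono fun μ => ?_
    rintro _ ⟨x, hx, rfl⟩
    rw [SetLike.mem_coe, mem_eigenspace_iff] at hx
    simp [LinearEquiv.conj_apply, hx]

theorem directSum {ι : Type*} {V : ι → Type*} [∀ i, AddCommGroup (V i)]
    [∀ i, Module F (V i)] {f : ∀ i, End F (V i)} (h : ∀ i, (f i).IsDiagonalizableAddSqZero) :
    End.IsDiagonalizableAddSqZero (DirectSum.lmap f) := by
  classical
  choose D M hf hM hD using h
  refine ⟨DirectSum.lmap D, DirectSum.lmap M, ?_, ?_, ?_⟩
  · ext i x : 2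
    simp [hf]
  · ext i x : 2
    have : M i (M i x) = 0 := LinearMap.congr_fun (hM i) x
    simp [this]
  · rw [eq_top_iff]
    intro x _
    induction x using DirectSum.induction_on with
    | zero => exact zero_mem _
    | add x y hx hy => exact add_mem (hx trivial) (hy trivial)
    | of i x =>
      have hx : x ∈ ⨆ μ, (D i).eigenspace μ := by rw [hD i]; trivial
      have hle : (⨆ μ, (D i).eigenspace μ).map (DirectSum.lof F ι V i) ≤
          ⨆ μ, End.eigenspace (DirectSum.lmap D) μ := by
        rw [Submodule.map_iSup]
        refine iSup_mono fun μ => ?_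
        rintro _ ⟨y, hy, rfl⟩
        rw [SetLike.mem_coe, mem_eigenspace_iff] at hy
        rw [mem_eigenspace_iff, DirectSum.lmap_lof, hy, map_smul]
      exact hle ⟨x, hx, rfl⟩

end Transport

/-! ### Operators in chain form -/

/-- If the eigenvectors of `D` for eigenvalues other than `c` span a subspace `E` and
`D x - c • x ∈ E`, then `D - c` being bijective on `E` allows one to correct `x` by an
element of `E` to a vector killed by `D - c`. -/
theorem mem_iSup_eigenspace_of_sub_smul_mem {F V : Type*} [Field F] [AddCommGroup V] [Module F V]
    (D : End F V) (c : F) {x : V} (hx : D x - c • x ∈ ⨆ μ, ⨆ (_ : μ ≠ c), D.eigenspace μ) :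
    x ∈ ⨆ μ, D.eigenspace μ := by
  have hle : ⨆ μ, ⨆ (_ : μ ≠ c), D.eigenspace μ ≤
      (⨆ μ, D.eigenspace μ).map (D - algebraMap F (End F V) c) := by
    refine iSup₂_le fun μ hμ y hy => ⟨(μ - c)⁻¹ • y, ?_, ?_⟩
    · exact Submodule.smul_mem _ _ (Submodule.mem_iSup_of_mem μ hy)
    · rw [mem_eigenspace_iff] at hy
      rw [map_smul, LinearMap.sub_apply, hy, algebraMap_end_apply, ← sub_smul, smul_smul,
        inv_mul_cancel₀ (sub_ne_zero.2 hμ), one_smul]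
  obtain ⟨u, hu, hux⟩ := hle hx
  have hxu : x - u ∈ D.eigenspace c := by
    rw [LinearMap.sub_apply, algebraMap_end_apply] at hux
    rw [mem_eigenspace_iff, map_sub, smul_sub, sub_eq_sub_iff_sub_eq_sub, hux]
  simpa using add_mem (Submodule.mem_iSup_of_mem c hxu) hu

/-- An operator that is lower bidiagonal in a basis, except for its last column, is the sum of a
diagonalizable and a square-zero operator if its diagonal entries are suitably distinct. The
square-zero part consists of every second subdiagonal entry, counted from the end. The basis is
given as a sequence `e`, of which only the values at `0, …, n` matter. -/
theorem of_chain_basis {F V : Type*} [Field F] [AddCommGroup V] [Module F V] {n : ℕ}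
    (f : End F V) (b : Basis (Fin (n + 1)) F V) (e : ℕ → V) (hb : ∀ i, b i = e i) (a : ℕ → F)
    (hf : ∀ j < n, f (e j) = a j • e j + e (j + 1))
    (hlast : f (e n) - a n • e n ∈ Submodule.span F (e '' Set.Iio n))
    (ha : ∀ j < n, a j ≠ a n) (ha' : ∀ j < n, Even (n + j) → a j ≠ a (j + 1)) :
    f.IsDiagonalizableAddSqZero := by
  let M : End F V := b.constr F fun i => if Odd (n + (i : ℕ)) then e (i + 1) else 0
  have hM : ∀ j ≤ n, M (e j) = if Odd (n + j) then e (j + 1) else 0 := by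
    intro j hj
    have := b.constr_basis F (fun i => if Odd (n + (i : ℕ)) then e (i + 1) else 0)
      ⟨j, Nat.lt_succ_of_le hj⟩
    rwa [hb] at this
  have hodd : ∀ j < n, Odd (n + j) → (f - M) (e j) = a j • e j := by
    intro j hj h
    rw [LinearMap.sub_apply, hf j hj, hM j hj.le, if_pos h, add_sub_cancel_right]
  have heven : ∀ j < n, Even (n + j) → (f - M) (e j) = a j • e j + e (j + 1) := by
    intro j hj h
    rw [LinearMap.sub_apply, hf j hj, hM j hj.le, if_neg (Nat.not_odd_iff_even.2 h), sub_zero]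
  have hn : (f - M) (e n) = f (e n) := by
    rw [LinearMap.sub_apply, hM n le_rfl, if_neg (Nat.not_odd_iff_even.2 ⟨n, rfl⟩), sub_zero]
  -- Below the last index, `f - M` is block diagonal with triangular blocks of size at most two.
  have hlow : ∀ j < n, e j ∈ ⨆ μ, ⨆ (_ : μ ≠ a n), (f - M).eigenspace μ := by
    have key : ∀ j < n, Odd (n + j) → e j ∈ ⨆ μ, ⨆ (_ : μ ≠ a n), (f - M).eigenspace μ :=
      fun j hj h => Submodule.mem_iSup_of_mem (a j) <| Submodule.mem_iSup_of_mem (ha j hj) <|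
        mem_eigenspace_iff.2 (hodd j hj h)
    intro j hj
    rcases Nat.even_or_odd (n + j) with h | h
    · have hj' : j + 1 < n := by grind
      have h' : Odd (n + (j + 1)) := by grind
      have hv : (a j - a (j + 1)) • e j + e (j + 1) ∈ (f - M).eigenspace (a j) := by
        rw [mem_eigenspace_iff, map_add, map_smul, heven j hj h, hodd _ hj' h']
        module
      have hv' : (a j - a (j + 1)) • e j + e (j + 1) ∈
          ⨆ μ, ⨆ (_ : μ ≠ a n), (f - M).eigenspace μ :=
        Submodule.mem_iSup_of_mem (a j) (Submodule.mem_iSup_of_mem (ha j hj) hv)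
      have := sub_mem hv' (key _ hj' h')
      rw [add_sub_cancel_right] at this
      exact (Submodule.smul_mem_iff _ (sub_ne_zero.2 (ha' j hj h))).1 this
    · exact key j hj h
  refine ⟨f - M, M, (sub_add_cancel f M).symm, ?_, ?_⟩
  · refine b.ext fun i => ?_
    rw [End.mul_apply, LinearMap.zero_apply, hb, hM i (Nat.lt_succ_iff.1 i.2)]
    split_ifs with h
    · have hi : (i : ℕ) + 1 ≤ n := by
        have := i.2
        grind
      rw [hM _ hi, if_neg (by grind)]
    · exact map_zero _
  · rw [eq_top_iff, ← b.span_eq, Submodule.span_le]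
    rintro _ ⟨i, rfl⟩
    rw [SetLike.mem_coe, hb]
    rcases (Nat.lt_succ_iff.1 i.2).lt_or_eq with h | h
    · have hle : ⨆ μ, ⨆ (_ : μ ≠ a n), (f - M).eigenspace μ ≤ ⨆ μ, (f - M).eigenspace μ :=
        iSup_mono fun μ => iSup_le fun _ => le_rfl
      exact hle (hlow i h)
    · rw [h]
      refine mem_iSup_eigenspace_of_sub_smul_mem (f - M) (a n) ?_
      rw [hn]
      refine Submodule.span_le.2 ?_ hlast
      rintro _ ⟨j, hj, rfl⟩
      exact hlow j hj

/-! ### Choice of the diagonal entries -/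

theorem sum_range_two_mul_alternating {R : Type*} [Ring R] (r : R) (k : ℕ) :
    ∑ i ∈ range (2 * k), (-1) ^ i * r = 0 := by
  induction k with
  | zero => simp
  | succ k ih => simp [mul_add, sum_range_succ, ih, pow_succ]

/-- The entries `a i` are those required by `of_chain_basis`, with prescribed sum `t`. This is where
the size and the parity of the field matter: the alternating entries `r, -r` need `r` nonzero and
different from `a n` and `-a n`. -/
theorem exists_diagonal_entries {F : Type*} [Field F] [Fintype F] (hodd : Odd (Fintype.card F))
    (hcard : 5 ≤ Fintype.card F) (n : ℕ) (t : F) :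
    ∃ a : ℕ → F, (∀ j < n, a j ≠ a n) ∧ (∀ j < n, Even (n + j) → a j ≠ a (j + 1)) ∧
      ∑ i ∈ range (n + 1), a i = t := by
  have h2 : (2 : F) ≠ 0 := Ring.two_ne_zero fun h =>
    Nat.not_even_iff_odd.2 hodd (Nat.even_iff.2 (FiniteField.even_card_of_char_two h))
  have havoid : ∀ x : F, ∃ r : F, r ≠ 0 ∧ r ≠ x ∧ r ≠ -x := by
    classical
    intro x
    obtain ⟨r, -, hr⟩ := Finset.exists_mem_notMem_of_card_lt_card (s := {0, x, -x})
      (t := (univ : Finset F)) (card_le_three.trans_lt (by rw [card_univ]; omega))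
    simp only [Finset.mem_insert, Finset.mem_singleton, not_or] at hr
    exact ⟨r, hr⟩
  have hself : ∀ r : F, r ≠ 0 → r ≠ -r := fun r hr h =>
    mul_ne_zero h2 hr (by linear_combination h)
  have hsgn : ∀ (r : F) (j : ℕ), (-1) ^ j * r = r ∨ (-1) ^ j * r = -r := fun r j => by
    rcases neg_one_pow_eq_or F j with h | h <;> simp [h]
  have hstep : ∀ (r : F) (j : ℕ), r ≠ 0 → (-1) ^ j * r ≠ (-1) ^ (j + 1) * r := fun r j hr => by
    rw [pow_succ]
    simpa using hself _ (mul_ne_zero (pow_ne_zero j (by simp : (-1 : F) ≠ 0)) hr)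
  rcases Nat.even_or_odd' n with ⟨k, rfl | rfl⟩
  · obtain ⟨r, hr0, hr, hr'⟩ := havoid t
    refine ⟨fun j => if j = 2 * k then t else (-1) ^ j * r, ?_, ?_, ?_⟩
    · intro j hj
      simp only [hj.ne, if_true, if_false]
      rcases hsgn r j with h | h <;> rw [h]
      · exact hr
      · exact fun h => hr' (neg_eq_iff_eq_neg.1 h)
    · intro j hj h
      have : j + 1 ≠ 2 * k := by grind
      simp only [hj.ne, this, if_false]
      exact hstep r j hr0
    · rw [sum_range_succ, sum_congr rfl (g := fun j => (-1) ^ j * r)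
        fun j hj => if_neg (mem_range.1 hj).ne, sum_range_two_mul_alternating]
      simp
  · obtain ⟨a, c, r, hac, ht, hr0, hr, hr'⟩ :
        ∃ a c r : F, a ≠ c ∧ a + c = t ∧ r ≠ 0 ∧ r ≠ c ∧ r ≠ -c := by
      -- For `t ≠ 0` the last entry is `0`, and the alternating entries are `1, -1`.
      by_cases ht : t = 0
      · obtain ⟨r, hr⟩ := havoid 1
        exact ⟨-1, 1, r, (hself 1 one_ne_zero).symm, by simp [ht], hr⟩
      · exact ⟨t, 0, 1, ht, by simp, by simp, by simp, by simp⟩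
    refine ⟨fun j => if j = 2 * k + 1 then c else if j = 0 then a else (-1) ^ j * r, ?_, ?_, ?_⟩
    · intro j hj
      simp only [hj.ne, if_true, if_false]
      split_ifs with h0
      · exact hac
      rcases hsgn r j with h | h <;> rw [h]
      · exact hr
      · exact fun h => hr' (neg_eq_iff_eq_neg.1 h)
    · intro j hj h
      have h1 : j + 1 ≠ 2 * k + 1 := by grind
      have h0 : j ≠ 0 := by grind
      simp only [hj.ne, h1, h0, if_false, Nat.succ_ne_zero]
      exact hstep r j hr0
    · rw [sum_range_succ, sum_range_succ', sum_congr rfl (g := fun j => -((-1) ^ j * r)),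
        sum_neg_distrib, sum_range_two_mul_alternating]
      · simpa using ht
      · intro j hj
        have : j ≠ 2 * k := (mem_range.1 hj).ne
        simp [this, pow_succ]

/-! ### Cyclic modules -/

theorem degreeLT_le_span_of_monic {F : Type*} [Field F] (p : ℕ → F[X]) (hp : ∀ j, (p j).Monic)
    (hdeg : ∀ j, (p j).natDegree = j) (k : ℕ) :
    degreeLT F k ≤ Submodule.span F (p '' Set.Iio k) := by
  induction k with
  | zero =>
    intro h hh
    rw [mem_degreeLT, Nat.cast_zero, Nat.WithBot.lt_zero_iff, degree_eq_bot] at hh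
    simp [hh]
  | succ k ih =>
    intro h hh
    rw [mem_degreeLT] at hh
    have hmem : h - h.coeff k • p k ∈ degreeLT F k := by
      rw [mem_degreeLT, degree_lt_iff_coeff_zero]
      intro i hi
      rcases hi.eq_or_lt with rfl | hi
      · have : (p k).coeff k = 1 := by simpa [hdeg k] using (hp k).coeff_natDegree
        simp [this]
      · rw [coeff_sub, coeff_smul, coeff_eq_zero_of_degree_lt
          (hh.trans_le (by exact_mod_cast hi)), coeff_eq_zero_of_natDegree_lt
          ((hdeg k).trans_lt hi), smul_zero, sub_zero]
    rw [← sub_add_cancel h (h.coeff k • p k)]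
    refine add_mem (Submodule.span_mono (Set.image_mono ?_) (ih hmem))
      (Submodule.smul_mem _ _ (Submodule.subset_span ⟨k, by simp, rfl⟩))
    exact Set.Iio_subset_Iio k.le_succ

/-- A cyclic `F[X]`-module `F[X] ⧸ (g)` is presented here by the quotient map `q`, and the
multiplication by `X` on it by `f`. -/
theorem of_cyclic {F V : Type*} [Field F] [Fintype F] (hodd : Odd (Fintype.card F))
    (hcard : 5 ≤ Fintype.card F) [AddCommGroup V] [Module F V] (f : End F V) (q : F[X] →ₗ[F] V)
    (hqs : Function.Surjective q) (hqX : ∀ h, f (q h) = q (X * h)) {g : F[X]} (hg : g ≠ 0)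
    (hqg : ∀ h, q (h * g) = 0) (hfin : finrank F V = g.natDegree) :
    f.IsDiagonalizableAddSqZero := by
  have hlead : g.leadingCoeff ≠ 0 := leadingCoeff_ne_zero.2 hg
  have hspan : ∀ x, ∃ h, h.degree < g.degree ∧ q h = x := by
    intro x
    obtain ⟨h, rfl⟩ := hqs x
    refine ⟨h % g, EuclideanDomain.mod_lt h hg, ?_⟩
    conv_rhs => rw [← EuclideanDomain.mod_add_div' h g, map_add, hqg, add_zero]
  rcases hn : g.natDegree with _ | n
  · refine ⟨0, 0, ?_, mul_zero _, ?_⟩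
    · ext x
      obtain ⟨h, hh, rfl⟩ := hspan x
      rw [degree_eq_natDegree hg, hn, Nat.cast_zero, Nat.WithBot.lt_zero_iff, degree_eq_bot] at hh
      simp [hh]
    · rw [eq_top_iff]
      exact fun x _ => Submodule.mem_iSup_of_mem 0 (mem_eigenspace_iff.2 (by simp))
  · -- The trace of `f` is minus the second coefficient of `g` made monic.
    obtain ⟨a, ha, ha', hsum⟩ :=
      exists_diagonal_entries hodd hcard n (-(g.leadingCoeff⁻¹ * g.coeff n))
    let p : ℕ → F[X] := fun j => ∏ i ∈ range j, (X - C (a i))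
    have hp : ∀ j, (p j).Monic := fun j => monic_prod_of_monic _ _ fun i _ => monic_X_sub_C _
    have hdeg : ∀ j, (p j).natDegree = j := fun j => by
      simp [p, natDegree_prod_of_monic _ _ fun i _ => monic_X_sub_C (a i)]
    have hsucc : ∀ j, p (j + 1) = X * p j - a j • p j := fun j => by
      rw [smul_eq_C_mul, ← sub_mul, mul_comm]
      exact prod_range_succ _ _
    have himg : ∀ (k : ℕ) (h : F[X]), h.degree < (k : WithBot ℕ) →
        q h ∈ Submodule.span F ((fun j => q (p j)) '' Set.Iio k) := by
      intro k h hh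
      have := Submodule.mem_map_of_mem (f := q)
        (degreeLT_le_span_of_monic p hp hdeg k (mem_degreeLT.2 hh))
      rwa [Submodule.map_span, ← Set.image_comp] at this
    let b : Basis (Fin (n + 1)) F V :=
      basisOfTopLeSpanOfCardEqFinrank (fun i => q (p i)) (by
        intro x _
        obtain ⟨h, hh, rfl⟩ := hspan x
        rw [degree_eq_natDegree hg, hn] at hh
        refine Submodule.span_mono ?_ (himg _ h hh)
        rintro _ ⟨j, hj, rfl⟩
        exact ⟨⟨j, hj⟩, rfl⟩) (by simp [hfin, hn])
    refine of_chain_basis (n := n) _ b (fun j => q (p j)) (fun i => by simp [b]) a ?_ ?_ ha ha'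
    · intro j _
      rw [hqX, hsucc, map_sub, map_smul]
      abel
    · have hred : q (X * p n) - a n • q (p n) = q (p (n + 1) - C g.leadingCoeff⁻¹ * g) := by
        rw [map_sub, hqg, hsucc, map_sub, map_smul, sub_zero]
      rw [hqX, hred]
      -- The sum of the `a i` is chosen such that this difference has no term of degree `n`.
      refine himg n _ ((degree_lt_iff_coeff_zero _ _).2 fun i hi => ?_)
      rcases hi.eq_or_lt with rfl | hi
      · have hc : (p (n + 1)).coeff n = - ∑ i ∈ range (n + 1), a i := by
          have := prod_X_sub_C_coeff_card_pred (range (n + 1)) a (by simp)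
          simpa using this
        rw [coeff_sub, coeff_C_mul, hc, hsum, neg_neg, sub_self]
      · rcases (Nat.succ_le_of_lt hi).eq_or_lt with rfl | hi
        · have h1 : (p (n + 1)).coeff (n + 1) = 1 := by
            simpa [hdeg (n + 1)] using (hp (n + 1)).coeff_natDegree
          have h2 : g.coeff (n + 1) = g.leadingCoeff := by rw [leadingCoeff, hn]
          rw [coeff_sub, coeff_C_mul, Nat.succ_eq_add_one, h1, h2, inv_mul_cancel₀ hlead, sub_self]
        · rw [coeff_sub, coeff_C_mul, coeff_eq_zero_of_natDegree_lt (by rw [hdeg]; exact hi),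
            coeff_eq_zero_of_natDegree_lt (by rw [hn]; exact hi), mul_zero, sub_zero]

theorem lsmul_X_quotient_span {F : Type*} [Field F] [Fintype F] (hodd : Odd (Fintype.card F))
    (hcard : 5 ≤ Fintype.card F) {g : F[X]} (hg : g ≠ 0) :
    End.IsDiagonalizableAddSqZero (Algebra.lsmul F F (F[X] ⧸ Ideal.span {g}) (X : F[X])) :=
  of_cyclic hodd hcard _ (Ideal.Quotient.mkₐ F (Ideal.span {g})).toLinearMap
    Ideal.Quotient.mk_surjective (fun _ => rfl) hg
    (fun h => Ideal.Quotient.eq_zero_iff_mem.2 (Ideal.mem_span_singleton'.2 ⟨h, rfl⟩))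
    finrank_quotient_span_eq_natDegree

/-! ### Reduction to cyclic modules -/

theorem of_finite_field {F V : Type*} [Field F] [Fintype F] (hodd : Odd (Fintype.card F))
    (hcard : 5 ≤ Fintype.card F) [AddCommGroup V] [Module F V] [FiniteDimensional F V]
    (f : End F V) : f.IsDiagonalizableAddSqZero := by
  have htors : Module.IsTorsion F[X] (AEval' f) := by
    intro x
    refine ⟨⟨minpoly F f, mem_nonZeroDivisors_of_ne_zero
      (minpoly.ne_zero (Algebra.IsIntegral.isIntegral f))⟩, ?_⟩
    obtain ⟨v, rfl⟩ := (AEval'.of f).surjective x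
    change minpoly F f • AEval.of F V f v = 0
    rw [← AEval.of_aeval_smul, minpoly.aeval, zero_smul, map_zero]
  obtain ⟨ι, _, p, hp, k, ⟨φ⟩⟩ := Module.equiv_directSum_of_isTorsion htors
  refine of_linearEquiv ((φ.restrictScalars F).symm.trans (AEval'.of f).symm) (fun x => ?_)
    (directSum fun i => lsmul_X_quotient_span hodd hcard (pow_ne_zero (k i) (hp i).ne_zero))
  have hX : DirectSum.lmap (fun i => Algebra.lsmul F F (F[X] ⧸ Ideal.span {p i ^ k i}) (X : F[X])) x
      = (X : F[X]) • x := by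
    ext i
    rfl
  rw [hX]
  apply (AEval'.of f).injective
  change AEval'.of f ((AEval'.of f).symm (φ.symm (X • x))) =
    AEval'.of f (f ((AEval'.of f).symm (φ.symm x)))
  rw [← AEval'.X_smul_of, LinearEquiv.apply_symm_apply, LinearEquiv.apply_symm_apply, map_smul]

end Module.End.IsDiagonalizableAddSqZero

/-! ### Return to matrices -/

theorem Matrix.isDiagonalizable_of_iSup_eigenspace_eq_top {F : Type*} [Field F] {n : ℕ}
    (A : Matrix (Fin n) (Fin n) F)
    (h : ⨆ μ, End.eigenspace (Matrix.toLin' A) μ = ⊤) : A.IsDiagonalizable := by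
  have hs : ⊤ ≤ Submodule.span F (⋃ μ, (End.eigenspace (Matrix.toLin' A) μ : Set (Fin n → F))) := by
    rw [Submodule.span_iUnion]
    simp [h]
  let b₀ := Basis.ofSpan hs
  have : Fintype _ := FiniteDimensional.fintypeBasisIndex b₀
  let b := b₀.reindex (Fintype.equivFinOfCardEq (by
    rw [← finrank_eq_card_basis b₀, finrank_fin_fun]))
  have hb : ∀ i, ∃ μ : F, A *ᵥ b i = μ • b i := by
    intro i
    have hmem : b i ∈ ⋃ μ, (End.eigenspace (Matrix.toLin' A) μ : Set (Fin n → F)) :=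
      Basis.ofSpan_subset hs ⟨_, (b₀.reindex_apply _ i).symm⟩
    obtain ⟨μ, hμ⟩ := Set.mem_iUnion.1 hmem
    exact ⟨μ, by simpa [End.mem_eigenspace_iff] using hμ⟩
  choose d hd using hb
  let B := (Pi.basisFun F (Fin n)).toMatrix b
  have hB : ∀ i j, B i j = b j i := fun i j => by simp [B, Basis.toMatrix_apply]
  refine ⟨⟨B, b.toMatrix (Pi.basisFun F (Fin n)), Basis.toMatrix_mul_toMatrix_flip _ _,
    Basis.toMatrix_mul_toMatrix_flip _ _⟩, d, ?_⟩
  have hAB : A * B = B * Matrix.diagonal d := by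
    ext i j
    rw [Matrix.mul_diagonal, hB, mul_comm]
    have := congrFun (hd j) i
    simpa [Matrix.mulVec, dotProduct, Matrix.mul_apply, hB] using this
  change b.toMatrix (Pi.basisFun F (Fin n)) * A * B = _
  rw [Matrix.mul_assoc, hAB, ← Matrix.mul_assoc, Basis.toMatrix_mul_toMatrix_flip, Matrix.one_mul]

theorem Matrix.IsDiagonalizable.pow_card {F : Type*} [Field F] [Fintype F] {n : Type*} [Fintype n]
    [DecidableEq n] {A : Matrix n n F} (h : A.IsDiagonalizable) : A ^ Fintype.card F = A := by
  obtain ⟨U, d, hU⟩ := h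
  have hA : A = U * Matrix.diagonal d * (↑U⁻¹ : Matrix n n F) := by
    rw [← hU]
    simp [mul_assoc]
  rw [hA, Units.conj_pow, Matrix.diagonal_pow]
  congr 3
  funext i
  exact FiniteField.pow_card (d i)

theorem theorem2p2 {F : Type*} [Field F] [Fintype F] (q : ℕ) (hcard : Fintype.card F = q)
    (hodd : Odd q) (hq : 5 ≤ q) (n : ℕ) (A : Matrix (Fin n) (Fin n) F) :
    ∃ D M : Matrix (Fin n) (Fin n) F,
      A = D + M ∧ D.IsDiagonalizable ∧ M ^ 2 = 0 ∧ D ^ q = D := by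
  subst hcard
  obtain ⟨D, M, hA, hM, hD⟩ :=
    End.IsDiagonalizableAddSqZero.of_finite_field hodd hq (Matrix.toLin' A)
  have hdiag : (LinearMap.toMatrix' D).IsDiagonalizable :=
    Matrix.isDiagonalizable_of_iSup_eigenspace_eq_top _ (by rwa [Matrix.toLin'_toMatrix'])
  refine ⟨LinearMap.toMatrix' D, LinearMap.toMatrix' M, ?_, hdiag, ?_, hdiag.pow_card⟩
  · rw [← map_add, ← hA, LinearMap.toMatrix'_toLin']
  · rw [sq, ← LinearMap.toMatrix'_mul, hM, map_zero]
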